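/- All Hilbert spaces are finite-dimensional, $k\in\mathbb N$, and player $i\in\{1,\dots,k\}$ has a set of settings $x_i$ and a finite set of outcomes $a_i$. Correlations $p(a_1\dots a_k|x_1\dots x_k)$ have a *$k$-partite Bell quantum model* if there are finite-dimensional spaces $\mathcal K_1,\dots,\mathcal K_k$, a density operator $\rho$ on $\mathcal K_1\otimes\dots\otimes\mathcal K_k$ and, for all $i$ and $x_i$, a POVM $\{M^i_{a_i|x_i}\}_{a_i}$ on $\mathcal K_i$ with $p(a_1\dots a_k|x_1\dots x_k)=\mathrm{Tr}[\rho\,(M^1_{a_1|x_1}\otimes\dots\otimes M^k_{a_k|x_k})]$ for all settings and outcomes. A *type of quantum objects* on $\mathcal H$ is a linear projection $\mathcal P$ on $B(\mathcal H)$ with a number $\gamma\in\mathbb R$; its deterministic objects are the operators $\Omega\ge 0$ with $\mathcal P(\Omega)=\Omega$ and $\mathrm{Tr}\,\Omega=\gamma$. For any set of deterministic objects, a *non-signalling assemblage* is a family of operators $O_{a|x}\ge 0$ for which there is one deterministic object $\Omega$ with $\sum_a O_{a|x}=\Omega$ for all $x$. A non-signalling assemblage of instruments is a family of completely positive maps $\mathcal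 I_{a|x}$ with $\sum_a\mathcal I_{a|x}=\mathcal I$ for all $x$, for one channel (CPTP map) $\mathcal I$. The Choi operator of a map $\mathcal I$ is $\tilde{\mathcal I}=\sum_{i,j}|i\rangle\langle j|\otimes\mathcal I(|i\rangle\langle j|)$. A *deterministic comb* with $n$ rounds, receiving $I_j$ and then sending $O_j$ in round $j$, is a positive operator $C=C^{(n)}$ on $\bigotimes_j I_j\otimes O_j$ such that $\mathrm{Tr}_{O_j}C^{(j)}=\mathbb 1_{I_j}\otimes C^{(j-1)}$ for $j=n,\dots,1$ with some operators $C^{(j)}$ and $C^{(0)}=1$ (one round: channels; two rounds: super-channels); an element of an assemblage of combs with two rounds is (the Choi operator of) an element of a super-instrument. If players $i=1,\dots,k$ insert objects on $\mathcal H_i$ from given sets of deterministic objects, a *valid network* is an operator $W\ge0$ on $\bigotimes_i\mathcal H_i$ with $\mathrm{Tr}[W(\Omega_1\otimes\dots\otimes\Omega_k)]=1$ for all deterministic $\Omega_i$. **Theorem 1.** Every composition of $k$ non-signalling quantum assemblages yields correlations that have a $k$-partite Bell quantum model. Precisely, this holds for the correlations $p(a_1\dots a_k|x_1\dots x_k)$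 in each of the following cases. 1. (General composition.) Player $i$ has a non-signalling assemblage $O^i_{a|x}$ of quantum objects of some type $(\mathcal P_i,\gamma_i)$ on $\mathcal H_i$, $W$ is a valid network for these types, and $p=\mathrm{Tr}[W(O^1_{a_1|x_1}\otimes\dots\otimes O^k_{a_k|x_k})]$. 2. (Sequential composition.) $\mathcal I^i_{a|x}$ from $B(\mathcal H_{i-1})$ to $B(\mathcal H_i)$ are non-signalling assemblages of instruments, $\rho_0$ is a density operator on $\mathcal H_0$, and $p=\mathrm{Tr}[\mathcal I^k_{a_k|x_k}(\cdots\mathcal I^1_{a_1|x_1}(\rho_0)\cdots)]$. (For $\dim\mathcal H_0=1$ the first player prepares states, for $\dim\mathcal H_k=1$ the last one measures.) 3. (Directed acyclic graphs.) The players are the nodes of a finite directed acyclic graph (with parallel edges allowed) whose edges carry nonzero Hilbert spaces, node $i$ has a non-signalling assemblage of instruments from the tensor product of its incoming spaces to that of its outgoing spaces, and $p$ is obtained by connecting all instruments along the edges. 4. (Process matrices.) Player $i$ has a non-signalling assemblage $\mathcal I^i_{a|x}$ of instruments, $W$ is a process matrix, that is, a valid network for the Choi operators of channels, and $p=\mathrm{Tr}[W(\tilde{\mathcal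 I}^1_{a_1|x_1}\otimes\dots\otimes\tilde{\mathcal I}^k_{a_k|x_k})]$. 5. (Loops via super-instruments and combs.) Player $i$ has a non-signalling assemblage of combs with any number $n_i$ of rounds. Finitely many wires carrying nonzero Hilbert spaces lead from rounds to rounds, of the same or of different players; the incoming and outgoing space of a round is the tensor product of the spaces of its incoming and outgoing wires; the relation on the rounds given by the wires and by the order of the rounds of each player has no directed cycle; and $p$ is obtained by contracting all combs along the wires (link product). 6. (Multi-round process matrices.) Player $i$ has a non-signalling assemblage $C^i_{a|x}$ of combs with any number $n_i$ of rounds, $W$ is a valid network for these deterministic combs, and $p=\mathrm{Tr}[W(C^1_{a_1|x_1}\otimes\dots\otimes C^k_{a_k|x_k})]$. -/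

import Mathlib

/-!
Finite-dimensional quantum theory in coordinates. A finite index type `ι` stands for the Hilbert
space `ℂ^ι`, operators on it are matrices `Matrix ι ι ℂ`, and the tensor product of the spaces
`ℂ^(ι i)` is `ℂ^(∀ i, ι i)`.
-/

open scoped ComplexOrder

namespace QNet

/-! ### Tensor products and Bell models -/

/-- The tensor product `⊗ᵢ M i` of finitely many operators. -/
def tensor {k : ℕ} {ι : Fin k → Type} (M : ∀ i, Matrix (ι i) (ι i) ℂ) :
    Matrix (∀ i, ι i) (∀ i, ι i) ℂ :=
  Matrix.of fun r c => ∏ i, M i (r i) (c i)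

/-- `ρ` is a density operator. -/
def IsState {ι : Type} [Fintype ι] (ρ : Matrix ι ι ℂ) : Prop :=
  ρ.PosSemidef ∧ ρ.trace = 1

/-- `{M a}` is a POVM. -/
def IsPOVM {ι : Type} [Fintype ι] [DecidableEq ι] {A : Type*} [Fintype A]
    (M : A → Matrix ι ι ℂ) : Prop :=
  (∀ a, (M a).PosSemidef) ∧ ∑ a, M a = 1

/-- The correlations `p(a₁,…,aₖ|x₁,…,xₖ)` have a `k`-partite Bell quantum model: finite-dimensional
local spaces, one shared state, and for every party and every setting a local POVM. -/
def HasBellModel {k : ℕ} {X : Fin k → Type*} {A : Fin k → Type*} [∀ i, Fintype (A i)]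
    (p : (∀ i, A i) → (∀ i, X i) → ℂ) : Prop :=
  ∃ (n : Fin k → ℕ) (ρ : Matrix (∀ i, Fin (n i)) (∀ i, Fin (n i)) ℂ)
    (M : ∀ i, X i → A i → Matrix (Fin (n i)) (Fin (n i)) ℂ),
    IsState ρ ∧ (∀ i x, IsPOVM (M i x)) ∧
      ∀ a x, p a x = (ρ * tensor fun i => M i (x i) (a i)).trace

/-! ### Quantum objects, non-signalling assemblages, general networks -/

/-- A type of quantum objects on `ℂ^ι` (in the Choi picture): a linear projection encoding the
causal constraints, and a normalization. -/
structure ObjectType (ι : Type) where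
  /-- the projection onto the subspace of operators obeying the constraints -/
  P : Matrix ι ι ℂ →ₗ[ℂ] Matrix ι ι ℂ
  isProj : ∀ O, P (P O) = P O
  /-- the trace of the normalized objects -/
  γ : ℝ

/-- The normalized (deterministic) objects of a type. -/
def ObjectType.deterministic {ι : Type} [Fintype ι] (τ : ObjectType ι) : Set (Matrix ι ι ℂ) :=
  {O | O.PosSemidef ∧ τ.P O = O ∧ O.trace = (τ.γ : ℂ)}

/-- `{O x a}` (the operator for outcome `a` and setting `x`) is a non-signalling assemblage of
objects with deterministic objects `D`: all elements are positive, and for every setting they sum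
up to one and the same deterministic object. -/
def IsNSAssemblage {ι : Type} (D : Set (Matrix ι ι ℂ)) {X A : Type*} [Fintype A]
    (O : X → A → Matrix ι ι ℂ) : Prop :=
  (∀ x a, (O x a).PosSemidef) ∧ ∃ Ω ∈ D, ∀ x, ∑ a, O x a = Ω

/-- `W` is a valid network (a generalized process matrix) connecting `k` players, the `i`-th of
whom inserts objects with deterministic objects `D i`: it is positive and assigns probability one
to every choice of deterministic objects. -/
def IsNetwork {k : ℕ} {ι : Fin k → Type} [∀ i, Fintype (ι i)]
    (D : ∀ i, Set (Matrix (ι i) (ι i) ℂ)) (W : Matrix (∀ i, ι i) (∀ i, ι i) ℂ) : Prop :=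
  W.PosSemidef ∧ ∀ Ω : ∀ i, Matrix (ι i) (ι i) ℂ, (∀ i, Ω i ∈ D i) → (W * tensor Ω).trace = 1

/-- The correlations `p(a|x) = Tr[W (O¹ ⊗ ⋯ ⊗ Oᵏ)]` with `Oⁱ = O i (x i) (a i)`. -/
def networkCorr {k : ℕ} {ι : Fin k → Type} [∀ i, Fintype (ι i)] {X : Fin k → Type*}
    {A : Fin k → Type*} (W : Matrix (∀ i, ι i) (∀ i, ι i) ℂ)
    (O : ∀ i, X i → A i → Matrix (ι i) (ι i) ℂ) (a : ∀ i, A i) (x : ∀ i, X i) : ℂ :=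
  (W * tensor fun i => O i (x i) (a i)).trace

/-! ### Instruments -/

/-- Linear maps from operators on `ℂ^ι` to operators on `ℂ^κ`. -/
abbrev OpMap (ι κ : Type) := Matrix ι ι ℂ →ₗ[ℂ] Matrix κ κ ℂ

/-- Complete positivity: `id ⊗ Φ` preserves positivity for every finite-dimensional ancilla. -/
def IsCP {ι κ : Type} (Φ : OpMap ι κ) : Prop :=
  ∀ (m : ℕ) (X : Matrix (Fin m × ι) (Fin m × ι) ℂ), X.PosSemidef →
    (Matrix.of fun s t : Fin m × κ =>
      Φ (Matrix.of fun i j => X (s.1, i) (t.1, j)) s.2 t.2).PosSemidef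

/-- Quantum channels: completely positive and trace preserving maps. -/
def IsChannel {ι κ : Type} [Fintype ι] [Fintype κ] (Φ : OpMap ι κ) : Prop :=
  IsCP Φ ∧ ∀ X, (Φ X).trace = X.trace

/-- `{Φ x a}` is a non-signalling assemblage of instruments. -/
def IsNSInstrument {ι κ : Type} [Fintype ι] [Fintype κ] {X A : Type*} [Fintype A]
    (Φ : X → A → OpMap ι κ) : Prop :=
  (∀ x a, IsCP (Φ x a)) ∧ ∃ Λ : OpMap ι κ, IsChannel Λ ∧ ∀ x, ∑ a, Φ x a = Λ

/-- The Choi operator `∑ᵢⱼ |i⟩⟨j| ⊗ Φ(|i⟩⟨j|)`. -/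
def choi {ι κ : Type} [DecidableEq ι] (Φ : OpMap ι κ) : Matrix (ι × κ) (ι × κ) ℂ :=
  Matrix.of fun s t => Φ (Matrix.single s.1 t.1 1) s.2 t.2

/-- The Choi operators of quantum channels. -/
def channelChoi (ι κ : Type) [Fintype ι] [Fintype κ] [DecidableEq ι] :
    Set (Matrix (ι × κ) (ι × κ) ℂ) :=
  {C | ∃ Φ : OpMap ι κ, IsChannel Φ ∧ C = choi Φ}

/-! ### Sequential composition -/

/-- The operator obtained from `ρ` after the maps of the first `j` players have been applied one
after the other. -/
def seqRun {k : ℕ} {d : ℕ → ℕ} (Φ : ∀ i : Fin k, OpMap (Fin (d i)) (Fin (d (i + 1))))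
    (ρ : Matrix (Fin (d 0)) (Fin (d 0)) ℂ) : ∀ j : ℕ, j ≤ k → Matrix (Fin (d j)) (Fin (d j)) ℂ
  | 0, _ => ρ
  | j + 1, h => Φ ⟨j, h⟩ (seqRun Φ ρ j (Nat.le_of_succ_le h))

/-- The correlations of the sequential scenario `Tr[Φᵏ(⋯ Φ²(Φ¹(ρ)) ⋯)]` with
`Φⁱ = Φ i (x i) (a i)`. -/
def seqCorr {k : ℕ} {d : ℕ → ℕ} {X : Fin k → Type*} {A : Fin k → Type*}
    (Φ : ∀ i : Fin k, X i → A i → OpMap (Fin (d i)) (Fin (d (i + 1))))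
    (ρ : Matrix (Fin (d 0)) (Fin (d 0)) ℂ) (a : ∀ i, A i) (x : ∀ i, X i) : ℂ :=
  (seqRun (fun i => Φ i (x i) (a i)) ρ k le_rfl).trace

/-! ### Directed acyclic graphs of instruments

A wire `e : E` carries the space `ℂ^(d e)`, from the node `src e` to the node `tgt e`. -/

/-- Basis of the tensor product of the spaces carried by the wires `e` with `f e = v`. For
`f = tgt` this is the input space of the node `v`, for `f = src` its output space. -/
abbrev Legs {E V : Type} (d : E → ℕ) (f : E → V) (v : V) : Type :=
  ∀ e : {e : E // f e = v}, Fin (d e)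

/-- The part of a labelling of all wires that the node `v` sees on its legs. -/
def onLegs {E V : Type} {d : E → ℕ} (f : E → V) (v : V) (r : ∀ e, Fin (d e)) : Legs d f v :=
  fun e => r e

/-- There is no directed cycle for the relation `R`. -/
def Acyclic {V : Type} (R : V → V → Prop) : Prop := ∀ v, ¬ Relation.TransGen R v v

/-- The correlations of a network of instruments: all outputs are plugged into the inputs they are
wired to, that is, for every wire the two legs that it joins are contracted. -/
def dagCorr {k : ℕ} {E : Type} [Fintype E] [DecidableEq E] {d : E → ℕ} {src tgt : E → Fin k}
    {X : Fin k → Type*} {A : Fin k → Type*}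
    (Φ : ∀ i, X i → A i → OpMap (Legs d tgt i) (Legs d src i))
    (a : ∀ i, A i) (x : ∀ i, X i) : ℂ :=
  ∑ r : ∀ e, Fin (d e), ∑ c : ∀ e, Fin (d e), ∏ i,
    Φ i (x i) (a i) (Matrix.single (onLegs tgt i r) (onLegs tgt i c) 1)
      (onLegs src i r) (onLegs src i c)

/-! ### Combs, and networks with loops -/

/-- Normalization of the Choi operator of a quantum comb with `n` rounds, where in round `j` the
comb receives `ℂ^(I j)` and then sends out `ℂ^(O j)`: tracing out the last output gives the
identity on the last input tensor a normalized comb with one round less; without rounds, it is the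
number `1`. -/
def CombNormalized : ∀ (n : ℕ) (I O : Fin n → Type) [∀ j, DecidableEq (I j)]
    [∀ j, Fintype (O j)], Matrix (∀ j, I j × O j) (∀ j, I j × O j) ℂ → Prop
  | 0, _, _, _, _, C => ∀ r c, C r c = 1
  | n + 1, I, O, _, _, C =>
    ∃ C' : Matrix (∀ j : Fin n, I j.castSucc × O j.castSucc)
        (∀ j : Fin n, I j.castSucc × O j.castSucc) ℂ,
      CombNormalized n (fun j => I j.castSucc) (fun j => O j.castSucc) C' ∧
      ∀ (r c : ∀ j : Fin n, I j.castSucc × O j.castSucc) (i i' : I (Fin.last n)),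
        ∑ o : O (Fin.last n),
            C (Fin.snoc (α := fun j => I j × O j) r (i, o))
              (Fin.snoc (α := fun j => I j × O j) c (i', o)) =
          if i = i' then C' r c else 0

/-- The deterministic quantum combs with `n` rounds. One round gives the channels, two rounds give
the super-channels. -/
def combs {n : ℕ} (I O : Fin n → Type) [∀ j, DecidableEq (I j)] [∀ j, Fintype (O j)] :
    Set (Matrix (∀ j, I j × O j) (∀ j, I j × O j) ℂ) :=
  {C | C.PosSemidef ∧ CombNormalized n I O C}

/-- The order between rounds: `s` precedes `t` directly if some wire leads from `s` to `t`, or if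
both are rounds of the same player and `s` is the earlier one. -/
def RoundBefore {k : ℕ} {n : Fin k → ℕ} {E : Type} (src tgt : E → (i : Fin k) × Fin (n i))
    (s t : (i : Fin k) × Fin (n i)) : Prop :=
  (∃ e, src e = s ∧ tgt e = t) ∨
    ∃ (i : Fin k) (j j' : Fin (n i)), j < j' ∧ s = ⟨i, j⟩ ∧ t = ⟨i, j'⟩

/-- The spaces received, respectively sent out, by player `i` in his rounds, when the wires `e` go
from round `src e` to round `tgt e`; use `f = tgt`, respectively `f = src`. -/
abbrev RoundLegs {k : ℕ} {n : Fin k → ℕ} {E : Type} (d : E → ℕ)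
    (f : E → (i : Fin k) × Fin (n i)) (i : Fin k) (j : Fin (n i)) : Type :=
  Legs d f ⟨i, j⟩

/-- The correlations of a wired network of combs: for every wire the two legs that it joins are
contracted (the link product of all Choi operators). -/
def combCorr {k : ℕ} {n : Fin k → ℕ} {E : Type} [Fintype E] [DecidableEq E] {d : E → ℕ}
    {src tgt : E → (i : Fin k) × Fin (n i)} {X : Fin k → Type*} {A : Fin k → Type*}
    (C : ∀ i, X i → A i → Matrix (∀ j, RoundLegs d tgt i j × RoundLegs d src i j)
      (∀ j, RoundLegs d tgt i j × RoundLegs d src i j) ℂ)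
    (a : ∀ i, A i) (x : ∀ i, X i) : ℂ :=
  ∑ r : ∀ e, Fin (d e), ∑ c : ∀ e, Fin (d e), ∏ i,
    C i (x i) (a i) (fun j => (onLegs tgt ⟨i, j⟩ r, onLegs src ⟨i, j⟩ r))
      (fun j => (onLegs tgt ⟨i, j⟩ c, onLegs src ⟨i, j⟩ c))

end QNet

open QNet

/-!
An ensemble `{O a}` of positive operators with sum `Ω` is a measurement in disguise: if `Ω = S Sᴴ`
and `S` has a left inverse `L`, then `M a = L (O a) Lᴴ` is a POVM and `O a = S (M a) Sᴴ`
(`exists_povm`). In a non-signalling assemblage the sum, and hence `S`, does not depend on the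
setting. So in any correlation that pairs the operators of the players with a positive operator `W`,
the maps `S` of all players can be absorbed into `W`. What remains is a positive operator `ρ` that is
measured by local POVMs, and the trace of `ρ` is the value of the network on the deterministic
objects, which is `1` (`hasBellModel_of_sum`).

For networks `W` given in advance this normalization is the hypothesis. For composed instruments and
combs, `W` is the contraction of the wires: it has the kernel `1` on pairs of labellings of the wires
(for sequences, a kernel made from the initial state and the final trace), which is positive. That
the contraction of deterministic objects is `1` follows for a sequence of channels from trace
preservation, and for acyclic wirings by tracing out sinks one after the other: a last node has
only traced outputs, so that it turns into the trace on its inputs (`sum_wiring_eq_one`). For combs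
the nodes are the rounds, and removing the last remaining round of a player replaces his comb by the
one with one round less (`CombNormalized.exists_chain`).
-/

namespace QNet

open Matrix

/-! ### Bell models from positive kernels -/

/-- A positive operator is `S Sᴴ` for an `S` with a left inverse `L`: restrict the spectral
decomposition to the nonzero eigenvalues. -/
theorem exists_factor {ι : Type} [Fintype ι] {Ω : Matrix ι ι ℂ} (hΩ : Ω.PosSemidef) :
    ∃ (n : ℕ) (S : Matrix ι (Fin n) ℂ) (L : Matrix (Fin n) ι ℂ), S * Sᴴ = Ω ∧ L * S = 1 := by
  classical
  set ev := hΩ.1.eigenvalues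
  let U : Matrix ι ι ℂ := hΩ.1.eigenvectorUnitary
  have hUU : Uᴴ * U = 1 := Unitary.coe_star_mul_self hΩ.1.eigenvectorUnitary
  have hspec : Ω = U * diagonal (fun j => (ev j : ℂ)) * Uᴴ := by
    conv_lhs => rw [hΩ.1.spectral_theorem, Unitary.conjStarAlgAut_apply]
    rfl
  let e := Fintype.equivFin {j // ev j ≠ 0}
  have hpos : ∀ j, 0 ≤ ev j := hΩ.eigenvalues_nonneg
  refine ⟨_, Matrix.of fun i m => U i (e.symm m) * (Real.sqrt (ev (e.symm m)) : ℂ),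
    Matrix.of fun m i => ((Real.sqrt (ev (e.symm m)))⁻¹ : ℂ) * star (U i (e.symm m)), ?_, ?_⟩
  · rw [hspec]
    ext i i'
    have hR : (U * diagonal (fun j => (ev j : ℂ)) * Uᴴ) i i' =
        ∑ j, U i j * (ev j : ℂ) * star (U i' j) := by
      rw [Matrix.mul_apply]
      simp only [mul_diagonal, conjTranspose_apply]
    have hF : ∀ j, U i j * (Real.sqrt (ev j) : ℂ) * star (U i' j * (Real.sqrt (ev j) : ℂ)) =
        U i j * (ev j : ℂ) * star (U i' j) := fun j => by
      have h : (Real.sqrt (ev j) : ℂ) * (Real.sqrt (ev j) : ℂ) = ev j := by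
        exact_mod_cast Real.mul_self_sqrt (hpos j)
      rw [← h, star_mul', Complex.star_def, Complex.conj_ofReal]
      ring
    rw [hR, ← Fintype.sum_subtype_add_sum_subtype (fun j => ev j ≠ 0)]
    simp only [Matrix.mul_apply, of_apply, conjTranspose_apply, hF]
    rw [e.symm.sum_comp (fun m : {j // ev j ≠ 0} => U i m * (ev m : ℂ) * star (U i' m)),
      Finset.sum_eq_zero (s := (Finset.univ : Finset {j // ¬ ev j ≠ 0}))
        fun j _ => by simp [not_not.1 j.2], add_zero]
  · ext m m'
    have h1 := congrFun (congrFun hUU (e.symm m)) (e.symm m')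
    simp only [mul_apply, of_apply, conjTranspose_apply] at h1 ⊢
    have h2 : ∀ m, (Real.sqrt (ev (e.symm m)) : ℂ) ≠ 0 := fun m => by
      have := (hpos _).lt_of_ne' (e.symm m).2
      exact_mod_cast (Real.sqrt_pos.2 this).ne'
    have h3 : ∀ i, ((Real.sqrt (ev (e.symm m)))⁻¹ : ℂ) * star (U i (e.symm m)) *
        (U i (e.symm m') * (Real.sqrt (ev (e.symm m')) : ℂ)) =
        ((Real.sqrt (ev (e.symm m)))⁻¹ : ℂ) * (Real.sqrt (ev (e.symm m')) : ℂ) *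
          (star (U i (e.symm m)) * U i (e.symm m')) := fun i => by ring
    simp only [h3]
    rw [← Finset.mul_sum, h1]
    by_cases h : m = m'
    · subst h; simp [h2]
    · simp [h, one_apply, Subtype.val_inj]

/-- The elements of an ensemble `{O a}` that sums up to `Ω = S Sᴴ` are `S M Sᴴ` for the POVM
`M a = L (O a) Lᴴ`, where `L` is a left inverse of `S`. -/
theorem exists_povm {ι : Type} [Fintype ι] {X A : Type*} [Fintype A] {Ω : Matrix ι ι ℂ}
    (hΩ : Ω.PosSemidef) {O : X → A → Matrix ι ι ℂ} (hO : ∀ x a, (O x a).PosSemidef)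
    (hsum : ∀ x, ∑ a, O x a = Ω) :
    ∃ (n : ℕ) (S : Matrix ι (Fin n) ℂ) (M : X → A → Matrix (Fin n) (Fin n) ℂ),
      S * Sᴴ = Ω ∧ (∀ x, IsPOVM (M x)) ∧ ∀ x a, O x a = S * M x a * Sᴴ := by
  classical
  obtain ⟨n, S, L, hS, hL⟩ := exists_factor hΩ
  have hL' : Sᴴ * Lᴴ = 1 := by rw [← conjTranspose_mul, hL, conjTranspose_one]
  refine ⟨n, S, fun x a => L * O x a * Lᴴ, hS,
    fun x => ⟨fun a => (hO x a).mul_mul_conjTranspose_same L, ?_⟩, fun x a => ?_⟩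
  · change ∑ a, L * O x a * Lᴴ = 1
    rw [← Matrix.sum_mul, ← Matrix.mul_sum, hsum, ← hS]
    calc L * (S * Sᴴ) * Lᴴ = (L * S) * (Sᴴ * Lᴴ) := by simp only [Matrix.mul_assoc]
      _ = 1 := by rw [hL, hL', Matrix.one_mul]
  -- `Q = 1 - S L` annihilates `Ω`, hence also every `O x a`, because `O x a ≤ Ω`.
  · set Q : Matrix ι ι ℂ := 1 - S * L with hQ
    have hQS : Q * S = 0 := by
      rw [hQ, Matrix.sub_mul, Matrix.mul_assoc, hL]; simp
    have hzero : ∑ b, (Q * O x b * Qᴴ).trace = 0 := by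
      rw [← trace_sum, ← Matrix.sum_mul, ← Matrix.mul_sum, hsum, ← hS, ← Matrix.mul_assoc, hQS]
      simp
    have hpsd : ∀ b, (Q * O x b * Qᴴ).PosSemidef := fun b => (hO x b).mul_mul_conjTranspose_same Q
    have h0 : Q * O x a * Qᴴ = 0 := by
      rw [← (hpsd a).trace_eq_zero_iff]
      exact (Finset.sum_eq_zero_iff_of_nonneg fun b _ => (hpsd b).trace_nonneg).1 hzero a
        (Finset.mem_univ a)
    obtain ⟨m, B, -, hB, -⟩ := exists_factor (hO x a)
    have h1 : Q * B = 0 := by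
      rw [← self_mul_conjTranspose_eq_zero, conjTranspose_mul, ← h0, ← hB]
      simp only [Matrix.mul_assoc]
    have h2 : Q * O x a = 0 := by rw [← hB, ← Matrix.mul_assoc, h1, Matrix.zero_mul]
    have h3 : S * L * O x a = O x a := by
      rw [hQ, Matrix.sub_mul, Matrix.one_mul, sub_eq_zero] at h2
      exact h2.symm
    have h4 : O x a * (S * L)ᴴ = O x a := by
      have := congrArg conjTranspose h3
      rwa [conjTranspose_mul, (hO x a).1] at this
    calc O x a = S * L * (O x a * (S * L)ᴴ) := by rw [h4, h3]
      _ = _ := by rw [conjTranspose_mul]; simp only [Matrix.mul_assoc]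

/-- The master construction. Write each player's deterministic object as `Ω i = S i (S i)ᴴ` and his
assemblage as `S i M (S i)ᴴ` with POVMs `M`. Moving the operators `S i` from the players to the
positive kernel `G` that joins them turns `G` into a positive operator on the product of the local
spaces, and the normalization for the `Ω i` says that its trace is `1`. Here `f r i` is the part of
the label `r` that player `i` sees. -/
theorem hasBellModel_of_sum {k : ℕ} {ι : Fin k → Type} [∀ i, Fintype (ι i)]
    {X : Fin k → Type*} {A : Fin k → Type*} [∀ i, Fintype (A i)]
    {O : ∀ i, X i → A i → Matrix (ι i) (ι i) ℂ} {Ω : ∀ i, Matrix (ι i) (ι i) ℂ}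
    (hO : ∀ i x a, (O i x a).PosSemidef) (hΩ : ∀ i, (Ω i).PosSemidef)
    (hsum : ∀ i x, ∑ a, O i x a = Ω i)
    {R : Type} [Fintype R] (f : R → ∀ i, ι i) {G : Matrix R R ℂ} (hG : G.PosSemidef)
    (hnorm : ∑ r, ∑ c, G c r * ∏ i, Ω i (f r i) (f c i) = 1) :
    HasBellModel fun a x => ∑ r, ∑ c, G c r * ∏ i, O i (x i) (a i) (f r i) (f c i) := by
  classical
  choose n S M hS hM hOM using fun i => exists_povm (hΩ i) (hO i) (hsum i)
  let T : Matrix R (∀ i, Fin (n i)) ℂ := Matrix.of fun r m => ∏ i, S i (f r i) (m i)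
  have key : ∀ N : ∀ i, Matrix (Fin (n i)) (Fin (n i)) ℂ,
      ∑ r, ∑ c, G c r * ∏ i, (S i * N i * (S i)ᴴ) (f r i) (f c i) =
        (Tᴴ * G * T * tensor N).trace := by
    intro N
    have h1 : ∀ r c, ∏ i, (S i * N i * (S i)ᴴ) (f r i) (f c i) = (T * tensor N * Tᴴ) r c := by
      intro r c
      simp only [mul_apply, conjTranspose_apply, Finset.prod_univ_sum, Fintype.piFinset_univ,
        Finset.prod_mul_distrib, T, of_apply, tensor, star_prod]
    have h2 : (Tᴴ * G * T * tensor N).trace = (G * (T * tensor N * Tᴴ)).trace := by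
      rw [Matrix.mul_assoc, Matrix.mul_assoc, trace_mul_comm, Matrix.mul_assoc]
    rw [h2, Finset.sum_comm]
    simp only [h1, trace, diag_apply, Matrix.mul_apply (M := G)]
  refine ⟨n, Tᴴ * G * T, M, ⟨hG.conjTranspose_mul_mul_same T, ?_⟩, hM, fun a x => ?_⟩
  · rw [← hnorm]
    have h1 : tensor (fun i => (1 : Matrix (Fin (n i)) (Fin (n i)) ℂ)) = 1 := by
      ext r c
      simp only [tensor, of_apply, one_apply, Finset.prod_ite_zero, Finset.prod_const_one,
        Finset.mem_univ, true_imp_iff, funext_iff]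
    have := key fun i => 1
    simp only [Matrix.mul_one, hS, h1] at this
    exact this.symm
  · rw [← key]
    simp only [← hOM]

theorem hasBellModel_networkCorr {k : ℕ} {ι : Fin k → Type} [∀ i, Fintype (ι i)]
    {X : Fin k → Type*} {A : Fin k → Type*} [∀ i, Fintype (A i)]
    {D : ∀ i, Set (Matrix (ι i) (ι i) ℂ)} (hD : ∀ i, ∀ Ω ∈ D i, Ω.PosSemidef)
    {W : Matrix (∀ i, ι i) (∀ i, ι i) ℂ} (hW : IsNetwork D W)
    {O : ∀ i, X i → A i → Matrix (ι i) (ι i) ℂ} (hO : ∀ i, IsNSAssemblage (D i) (O i)) :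
    HasBellModel (networkCorr W O) := by
  choose hpos Ω hΩ hsum using hO
  have tr : ∀ N : ∀ i, Matrix (ι i) (ι i) ℂ,
      ∑ r, ∑ c, W c r * ∏ i, N i (r i) (c i) = (W * tensor N).trace := fun N => by
    rw [Finset.sum_comm]; simp only [trace, diag_apply, mul_apply, tensor, of_apply]
  have := hasBellModel_of_sum hpos (fun i => hD i _ (hΩ i)) hsum id hW.1
    (by simpa only [id, tr] using hW.2 Ω hΩ)
  simp only [id, tr] at this
  exact this

/-! ### Choi operators -/

theorem choi_apply {ι κ : Type} [DecidableEq ι] (Φ : OpMap ι κ) (s t : ι × κ) :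
    choi Φ s t = Φ (single s.1 t.1 1) s.2 t.2 := rfl

/-- The Choi operator is the image of a maximally entangled state. -/
theorem IsCP.posSemidef_choi {ι κ : Type} [Fintype ι] [Fintype κ] [DecidableEq ι] {Φ : OpMap ι κ}
    (h : IsCP Φ) : (choi Φ).PosSemidef := by
  let e := Fintype.equivFin ι
  let v : Fin (Fintype.card ι) × ι → ℂ := fun s => if e.symm s.1 = s.2 then 1 else 0
  have := (h _ _ (posSemidef_vecMulVec_self_star v)).submatrix
    (fun s : ι × κ => (e s.1, s.2))
  convert this using 1
  ext s t
  have hv : single s.1 t.1 (1 : ℂ) =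
      Matrix.of fun i j => vecMulVec v (star v) (e s.1, i) (e t.1, j) := by
    ext i j
    by_cases h1 : s.1 = i <;> by_cases h2 : t.1 = j <;>
      simp [v, vecMulVec_apply, h1, h2]
  rw [choi_apply, hv]
  rfl

theorem IsNSInstrument.choi {ι κ : Type} [Fintype ι] [Fintype κ] [DecidableEq ι] {X A : Type*}
    [Fintype A] {Φ : X → A → OpMap ι κ} (h : IsNSInstrument Φ) :
    IsNSAssemblage (channelChoi ι κ) fun x a => choi (Φ x a) := by
  obtain ⟨hcp, Λ, hΛ, hsum⟩ := h
  refine ⟨fun x a => (hcp x a).posSemidef_choi, _, ⟨Λ, hΛ, rfl⟩, fun x => ?_⟩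
  ext s t
  rw [← hsum x]
  simp [Matrix.sum_apply, choi_apply]

theorem posSemidef_of_mem_channelChoi {ι κ : Type} [Fintype ι] [Fintype κ] [DecidableEq ι]
    {C : Matrix (ι × κ) (ι × κ) ℂ} (h : C ∈ channelChoi ι κ) : C.PosSemidef := by
  obtain ⟨Φ, hΦ, rfl⟩ := h
  exact hΦ.1.posSemidef_choi

/-! ### Normalization of acyclic wirings -/

section Wiring

variable {E V : Type} {d : E → ℕ} {src tgt f : E → V}

/-- The labelling `r` of all wires, with the labels of the legs of the node `v` replaced by `o`. -/
def relabel [DecidableEq V] (f : E → V) (v : V) (r : ∀ e, Fin (d e)) (o : Legs d f v) :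
    ∀ e, Fin (d e) :=
  fun e => if h : f e = v then o ⟨e, h⟩ else r e

theorem relabel_of_ne [DecidableEq V] {v : V} {e : E} (h : f e ≠ v) (r : ∀ e, Fin (d e))
    (o : Legs d f v) : relabel f v r o e = r e := dif_neg h

theorem onLegs_relabel_self [DecidableEq V] (f : E → V) (v : V) (r : ∀ e, Fin (d e))
    (o : Legs d f v) : onLegs f v (relabel f v r o) = o := by
  funext e
  exact dif_pos e.2

theorem onLegs_relabel_of_ne [DecidableEq V] {v w : V} (h : ∀ e, tgt e = w → src e ≠ v)
    (r : ∀ e, Fin (d e)) (o : Legs d src v) :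
    onLegs tgt w (relabel src v r o) = onLegs tgt w r := by
  funext e
  exact relabel_of_ne (h e e.2) r o

/-- Contracting the two copies of the output legs of `v` amounts to pinning these legs to the
labels `z` and performing the contraction inside the summand. -/
theorem sum_contract_legs [Fintype E] [DecidableEq E] [DecidableEq V] (f : E → V) (v : V)
    (z : ∀ e, Fin (d e)) (H : (∀ e, Fin (d e)) → (∀ e, Fin (d e)) → ℂ) :
    (∑ r, ∑ c, if onLegs f v r = onLegs f v c then H r c else 0) =
      ∑ r, ∑ c, if onLegs f v r = onLegs f v z ∧ onLegs f v c = onLegs f v z then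
        ∑ o, H (relabel f v r o) (relabel f v c o) else 0 := by
  -- Split the labels into those on the legs of `v` and the others.
  let q := Equiv.piEquivPiSubtypeProd (fun e => f e = v) fun e => Fin (d e)
  have hq1 : ∀ p, onLegs f v (q.symm p) = p.1 := fun p => by
    funext e; exact dif_pos e.2
  have hq2 : ∀ p o, relabel f v (q.symm p) o = q.symm (o, p.2) := fun p o => by
    funext e
    by_cases h : f e = v
    · simp [relabel, q, Equiv.piEquivPiSubtypeProd, h]
    · simp [relabel, q, Equiv.piEquivPiSubtypeProd, h]
  have hsum : ∀ F : (∀ e, Fin (d e)) → ℂ, ∑ r, F r = ∑ y, ∑ o, F (q.symm (o, y)) := fun F => by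
    rw [← q.symm.sum_comp, Fintype.sum_prod_type_right]
  simp only [hsum, hq1, hq2]
  refine Finset.sum_congr rfl fun y _ => ?_
  rw [Finset.sum_comm]
  conv_rhs => rw [Finset.sum_comm]
  refine Finset.sum_congr rfl fun y' _ => ?_
  simp [ite_and]

/-- For a set `S` of nodes whose wires are contracted, the condition on the two labels of each
wire: a wire that leads out of `S` is traced over, and the labels of wires that do not start in `S`
are pinned to `z`. -/
def Admissible (src tgt : E → V) (z : ∀ e, Fin (d e)) (S : Finset V) (r c : ∀ e, Fin (d e)) :
    Prop :=
  ∀ e, (tgt e ∉ S → r e = c e) ∧ (src e ∉ S → r e = z e ∧ c e = z e)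

/-- `S` contains all predecessors of its elements. -/
def DownClosed (R : V → V → Prop) (S : Finset V) : Prop :=
  ∀ u v, R u v → v ∈ S → u ∈ S

/-- In an acyclic relation every nonempty finite set has an element without successors in it. -/
theorem exists_last {R : V → V → Prop} [Finite V] (hR : Acyclic R) {S : Finset V}
    (hS : S.Nonempty) : ∃ s ∈ S, ∀ t ∈ S, ¬ R s t := by
  have : Std.Irrefl (Function.swap (Relation.TransGen R)) := ⟨fun v => hR v⟩
  have : IsTrans V (Function.swap (Relation.TransGen R)) := ⟨fun _ _ _ h h' => h'.trans h⟩
  obtain ⟨s, hs, h⟩ := (Finite.wellFounded_of_trans_of_irrefl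
    (Function.swap (Relation.TransGen R))).has_min (S : Set V) hS
  exact ⟨s, hs, fun t ht hst => h t ht (.single hst)⟩

/-- Normalization by removing the nodes one at a time, sinks first. `G S` stands for the product of
the operators of the nodes in a down-closed set `S`. By `hG`, tracing out the output of a sink `s` of
`insert s S` traces out its input wires and leaves `G S`, so the contraction over the admissible
labels does not change until no node is left. Pinning the wires that are no longer in use needs a
label for each of them, whence `hd`. -/
theorem sum_wiring_eq_one [Fintype E] [DecidableEq E] [Fintype V] [DecidableEq V]
    (hd : ∀ e, 0 < d e) {R : V → V → Prop} (hR : Acyclic R) (hsrc : ∀ e, R (src e) (tgt e))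
    (G : Finset V → (∀ e, Fin (d e)) → (∀ e, Fin (d e)) → ℂ) (hG0 : ∀ r c, G ∅ r c = 1)
    (hG : ∀ S s, DownClosed R S → DownClosed R (insert s S) → s ∉ S → ∀ r c,
      ∑ o, G (insert s S) (relabel src s r o) (relabel src s c o) =
        if onLegs tgt s r = onLegs tgt s c then G S r c else 0) :
    ∑ r, ∑ c, G Finset.univ r c = 1 := by
  classical
  let z : ∀ e, Fin (d e) := fun e => ⟨0, hd e⟩
  have main : ∀ S : Finset V, DownClosed R S →
      (∑ r, ∑ c, if Admissible src tgt z S r c then G S r c else 0) = 1 := by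
    intro S
    induction S using Finset.strongInduction with
    | H S ih =>
      intro hS
      rcases S.eq_empty_or_nonempty with rfl | hne
      · have h : ∀ r c, Admissible src tgt z ∅ r c ↔ r = z ∧ c = z := fun r c =>
          ⟨fun h => ⟨funext fun e => ((h e).2 (by simp)).1, funext fun e => ((h e).2 (by simp)).2⟩,
            by rintro ⟨rfl, rfl⟩ e; simp⟩
        simp [h, hG0, ite_and]
      · obtain ⟨s, hs, hlast⟩ := exists_last hR hne
        obtain ⟨T, hsT, rfl⟩ : ∃ T, s ∉ T ∧ insert s T = S :=
          ⟨S.erase s, by simp, Finset.insert_erase hs⟩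
        have hT : DownClosed R T := fun u v huv hv => by
          rcases Finset.mem_insert.1 (hS u v huv (Finset.mem_insert_of_mem hv)) with rfl | h
          · exact absurd huv (hlast v (Finset.mem_insert_of_mem hv))
          · exact h
        rw [← ih T (Finset.ssubset_insert hsT) hT]
        -- The part of the condition that does not concern the wires adjacent to `s`.
        let P : (∀ e, Fin (d e)) → (∀ e, Fin (d e)) → Prop := fun r c => ∀ e, src e ≠ s →
          (tgt e ∉ insert s T → r e = c e) ∧ (src e ∉ insert s T → r e = z e ∧ c e = z e)
        have hadm : ∀ r c, Admissible src tgt z (insert s T) r c ↔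
            onLegs src s r = onLegs src s c ∧ P r c := by
          intro r c
          constructor
          · intro h
            refine ⟨funext fun e => (h e).1 fun ht => hlast _ ht ?_, fun e _ => h e⟩
            have := hsrc e
            rwa [e.2] at this
          · rintro ⟨h, hP⟩ e
            by_cases he : src e = s
            · exact ⟨fun _ => congrFun h ⟨e, he⟩, fun h' => absurd (by simp [he]) h'⟩
            · exact hP e he
        have hadm' : ∀ r c, Admissible src tgt z T r c ↔
            (onLegs src s r = onLegs src s z ∧ onLegs src s c = onLegs src s z) ∧ P r c ∧
              onLegs tgt s r = onLegs tgt s c := by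
          intro r c
          constructor
          · intro h
            refine ⟨⟨funext fun e => ((h e).2 (by rw [e.2]; exact hsT)).1,
              funext fun e => ((h e).2 (by rw [e.2]; exact hsT)).2⟩,
              fun e _ => ⟨fun h' => (h e).1 fun h'' => h' (Finset.mem_insert_of_mem h''),
                fun h' => (h e).2 fun h'' => h' (Finset.mem_insert_of_mem h'')⟩,
              funext fun e => (h e).1 (by rw [e.2]; exact hsT)⟩
          · rintro ⟨⟨h1, h2⟩, hP, h3⟩ e
            by_cases he : src e = s
            · have e1 : r e = z e := congrFun h1 ⟨e, he⟩
              have e2 : c e = z e := congrFun h2 ⟨e, he⟩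
              exact ⟨fun _ => e1.trans e2.symm, fun _ => ⟨e1, e2⟩⟩
            · refine ⟨fun h => ?_, fun h => (hP e he).2 (by simp [he, h])⟩
              by_cases ht : tgt e = s
              · exact congrFun h3 ⟨e, ht⟩
              · exact (hP e he).1 (by simp [ht, h])
        have hPr : ∀ r c o o', P (relabel src s r o) (relabel src s c o') ↔ P r c := by
          intro r c o o'
          refine forall₂_congr fun e he => ?_
          rw [relabel_of_ne he, relabel_of_ne he]
        simp only [hadm, hadm', ite_and]
        rw [sum_contract_legs src s z]
        refine Finset.sum_congr rfl fun r _ => Finset.sum_congr rfl fun c _ => ?_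
        simp only [hPr, ite_and]
        split_ifs with h1 h2 h3 h4 <;> simp_all
  have := main Finset.univ fun _ _ _ _ => Finset.mem_univ _
  simpa [Admissible] using this

end Wiring

/-! ### Networks of channels -/

/-- Trace preservation, on the matrix units. -/
theorem IsChannel.sum_diag {ι κ : Type} [Fintype ι] [Fintype κ] [DecidableEq ι] {Φ : OpMap ι κ}
    (h : IsChannel Φ) (i j : ι) : ∑ o, Φ (single i j 1) o o = if i = j then 1 else 0 := by
  have := h.2 (single i j 1)
  rw [trace] at this
  simp only [diag_apply] at this
  rw [this]
  by_cases hij : i = j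
  · subst hij; simp
  · simp [hij, trace_single_eq_of_ne]

theorem sum_dag_channels_eq_one {k : ℕ} {E : Type} [Fintype E] [DecidableEq E] {d : E → ℕ}
    {src tgt : E → Fin k} (hd : ∀ e, 0 < d e)
    (hR : Acyclic fun u v => ∃ e, src e = u ∧ tgt e = v)
    {Λ : ∀ i, OpMap (Legs d tgt i) (Legs d src i)} (hΛ : ∀ i, IsChannel (Λ i)) :
    ∑ r : ∀ e, Fin (d e), ∑ c : ∀ e, Fin (d e), ∏ i,
      Λ i (single (onLegs tgt i r) (onLegs tgt i c) 1) (onLegs src i r) (onLegs src i c) = 1 := by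
  refine sum_wiring_eq_one hd hR (fun e => ⟨e, rfl, rfl⟩) (fun S r c => ∏ i ∈ S,
    Λ i (single (onLegs tgt i r) (onLegs tgt i c) 1) (onLegs src i r) (onLegs src i c))
    (fun _ _ => rfl) fun S s hS hS' hs r c => ?_
  have hne : ∀ i ∈ insert s S, ∀ e, tgt e = i → src e ≠ s := by
    intro i hi e he hes
    rcases Finset.mem_insert.1 hi with rfl | hi
    · exact hR _ (.single ⟨e, hes, he⟩)
    · exact hs (hS s i ⟨e, hes, he⟩ hi)
  have h1 : ∀ o, ∏ i ∈ S, Λ i (single (onLegs tgt i (relabel src s r o))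
        (onLegs tgt i (relabel src s c o)) 1) (onLegs src i (relabel src s r o))
          (onLegs src i (relabel src s c o)) =
      ∏ i ∈ S, Λ i (single (onLegs tgt i r) (onLegs tgt i c) 1)
        (onLegs src i r) (onLegs src i c) := fun o => by
    refine Finset.prod_congr rfl fun i hi => ?_
    have hi' : ∀ e, src e = i → src e ≠ s := fun e he h => hs (by rwa [← h, he])
    rw [onLegs_relabel_of_ne (hne i (Finset.mem_insert_of_mem hi)),
      onLegs_relabel_of_ne (hne i (Finset.mem_insert_of_mem hi)), onLegs_relabel_of_ne hi',
      onLegs_relabel_of_ne hi']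
  simp only [Finset.prod_insert hs, h1, onLegs_relabel_self,
    onLegs_relabel_of_ne (hne s (Finset.mem_insert_self s S))]
  rw [← Finset.sum_mul, (hΛ s).sum_diag]
  split_ifs <;> simp

theorem posSemidef_ones {R : Type} [Fintype R] :
    (Matrix.of fun _ _ => 1 : Matrix R R ℂ).PosSemidef := by
  convert posSemidef_vecMulVec_self_star (1 : R → ℂ) using 1
  ext; simp [vecMulVec_apply]

theorem hasBellModel_dagCorr {k : ℕ} {X : Fin k → Type*} {A : Fin k → Type*}
    [∀ i, Fintype (A i)] {E : Type} [Fintype E] [DecidableEq E] {d : E → ℕ} {src tgt : E → Fin k}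
    {Φ : ∀ i, X i → A i → OpMap (Legs d tgt i) (Legs d src i)} (hd : ∀ e, 0 < d e)
    (hR : Acyclic fun u v => ∃ e, src e = u ∧ tgt e = v) (hΦ : ∀ i, IsNSInstrument (Φ i)) :
    HasBellModel (dagCorr Φ) := by
  choose hpos Ω hΩ hsum using fun i => (hΦ i).choi
  choose Λ hΛ hΩΛ using hΩ
  have := hasBellModel_of_sum hpos (fun i => posSemidef_of_mem_channelChoi ⟨Λ i, hΛ i, hΩΛ i⟩) hsum
    (fun (r : ∀ e, Fin (d e)) i => (onLegs tgt i r, onLegs src i r)) posSemidef_ones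
    (by simpa only [hΩΛ, choi_apply, of_apply, one_mul] using sum_dag_channels_eq_one hd hR hΛ)
  simp only [choi_apply, of_apply, one_mul] at this
  exact this

/-! ### Sequential composition -/

theorem apply_eq_sum_choi {ι κ : Type} [Fintype ι] [DecidableEq ι] (Φ : OpMap ι κ)
    (ρ : Matrix ι ι ℂ) (u v : κ) :
    Φ ρ u v = ∑ i, ∑ j, ρ i j * choi Φ (i, u) (j, v) := by
  conv_lhs => rw [matrix_eq_sum_single ρ]
  simp only [map_sum, Matrix.sum_apply, choi_apply]
  refine Finset.sum_congr rfl fun i _ => Finset.sum_congr rfl fun j _ => ?_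
  have : single i j (ρ i j) = ρ i j • single i j 1 := by simp [smul_single]
  rw [this, map_smul, Matrix.smul_apply, smul_eq_mul]

/-- Path expansion: testing the output of a sequence of maps with `N` gives a sum over two labels
of every intermediate space, with a Choi entry for every map. -/
theorem sum_mul_seqRun {k : ℕ} {d : ℕ → ℕ} (Φ : ∀ i : Fin k, OpMap (Fin (d i)) (Fin (d (i + 1))))
    (ρ : Matrix (Fin (d 0)) (Fin (d 0)) ℂ) (j : ℕ) (hj : j ≤ k)
    (N : Matrix (Fin (d j)) (Fin (d j)) ℂ) :
    ∑ u, ∑ v, N u v * seqRun Φ ρ j hj u v =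
      ∑ r : ∀ l : Fin (j + 1), Fin (d l), ∑ c : ∀ l : Fin (j + 1), Fin (d l),
        N (r (Fin.last j)) (c (Fin.last j)) * ρ (r 0) (c 0) *
          ∏ i : Fin j, choi (Φ (i.castLE hj)) (r i.castSucc, r i.succ) (c i.castSucc, c i.succ) := by
  induction j with
  | zero =>
    -- A path of length zero is a single label.
    have hsum : ∀ F : (∀ l : Fin 1, Fin (d l)) → ℂ, ∑ r, F r = ∑ u : Fin (d 0), F fun l =>
        (Fin.cast (by rw [Subsingleton.elim l 0]; rfl) u) := fun F => by
      let e : Fin (d 0) ≃ (∀ l : Fin 1, Fin (d l)) :=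
        (Equiv.piUnique (fun l : Fin 1 => Fin (d l))).symm
      rw [← e.sum_comp]
      refine Finset.sum_congr rfl fun u _ => congrArg F ?_
      funext l
      obtain rfl := Subsingleton.elim l 0
      rfl
    simp only [hsum, seqRun, Finset.univ_eq_empty, Finset.prod_empty, mul_one]
    rfl
  | succ j ih =>
    have hsum : ∀ F : (∀ l : Fin (j + 2), Fin (d l)) → ℂ, ∑ r, F r =
        ∑ r : ∀ l : Fin (j + 1), Fin (d l), ∑ u : Fin (d (j + 1)),
          F (Fin.snoc (α := fun l : Fin (j + 2) => Fin (d l)) r u) := fun F => by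
      rw [← (Fin.snocEquiv fun l : Fin (j + 2) => Fin (d l)).sum_comp, Fintype.sum_prod_type_right]
      rfl
    have hj' : j ≤ k := Nat.le_of_succ_le hj
    -- The test operator `N`, pulled back along the last map.
    let N' : Matrix (Fin (d j)) (Fin (d j)) ℂ := Matrix.of fun u' v' =>
      ∑ u, ∑ v, N u v * choi (Φ ⟨j, hj⟩) (u', u) (v', v)
    have h1 : ∑ u, ∑ v, N u v * seqRun Φ ρ (j + 1) hj u v =
        ∑ u', ∑ v', N' u' v' * seqRun Φ ρ j hj' u' v' := by
      simp only [seqRun, N', of_apply]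
      simp only [apply_eq_sum_choi (Φ ⟨j, hj⟩) (seqRun Φ ρ j hj'), Finset.mul_sum, Finset.sum_mul]
      have hcomm : ∀ F : Fin (d (j + 1)) → Fin (d (j + 1)) → Fin (d j) → Fin (d j) → ℂ,
          ∑ u, ∑ v, ∑ u', ∑ v', F u v u' v' = ∑ u', ∑ v', ∑ u, ∑ v, F u v u' v' := fun F => by
        have := Finset.sum_comm (s := Finset.univ) (t := Finset.univ)
          (f := fun (p : Fin (d (j + 1)) × Fin (d (j + 1))) (q : Fin (d j) × Fin (d j)) =>
            F p.1 p.2 q.1 q.2)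
        simpa only [Fintype.sum_prod_type] using this
      rw [hcomm]
      refine Finset.sum_congr rfl fun u' _ => Finset.sum_congr rfl fun v' _ =>
        Finset.sum_congr rfl fun u _ => Finset.sum_congr rfl fun v _ => ?_
      ring
    rw [h1, ih hj' N', hsum]
    simp only [hsum]
    refine Finset.sum_congr rfl fun r _ => ?_
    rw [Finset.sum_comm]
    refine Finset.sum_congr rfl fun c _ => ?_
    simp only [N', of_apply, Finset.sum_mul]
    refine Finset.sum_congr rfl fun u _ => Finset.sum_congr rfl fun v _ => ?_
    rw [Fin.prod_univ_castSucc]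
    have h0 : ∀ (q : ∀ l : Fin (j + 1), Fin (d l)) (w : Fin (d (j + 1))),
        Fin.snoc (α := fun l : Fin (j + 2) => Fin (d l)) q w 0 = q 0 := fun q w =>
      Fin.snoc_castSucc (α := fun l : Fin (j + 2) => Fin (d l)) w q 0
    have hlast : ∀ (q : ∀ l : Fin (j + 1), Fin (d l)) (w : Fin (d (j + 1))),
        Fin.snoc (α := fun l : Fin (j + 2) => Fin (d l)) q w (Fin.last (j + 1)) = w := fun q w =>
      Fin.snoc_last (α := fun l : Fin (j + 2) => Fin (d l)) w q
    have hcast : ∀ (q : ∀ l : Fin (j + 1), Fin (d l)) (w : Fin (d (j + 1))) (l : Fin (j + 1)),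
        Fin.snoc (α := fun l : Fin (j + 2) => Fin (d l)) q w l.castSucc = q l := fun q w l =>
      Fin.snoc_castSucc (α := fun l : Fin (j + 2) => Fin (d l)) w q l
    have hsucc : ∀ (q : ∀ l : Fin (j + 1), Fin (d l)) (w : Fin (d (j + 1))) (l : Fin j),
        Fin.snoc (α := fun l : Fin (j + 2) => Fin (d l)) q w l.castSucc.succ = q l.succ :=
      fun q w l => hcast q w l.succ
    have hlast' : ∀ (q : ∀ l : Fin (j + 1), Fin (d l)) (w : Fin (d (j + 1))),
        Fin.snoc (α := fun l : Fin (j + 2) => Fin (d l)) q w (Fin.last j).succ = w := hlast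
    have hprod : ∏ l : Fin j, choi (Φ (l.castSucc.castLE hj))
          (Fin.snoc (α := fun l : Fin (j + 2) => Fin (d l)) r u l.castSucc.castSucc,
            Fin.snoc (α := fun l : Fin (j + 2) => Fin (d l)) r u l.castSucc.succ)
          (Fin.snoc (α := fun l : Fin (j + 2) => Fin (d l)) c v l.castSucc.castSucc,
            Fin.snoc (α := fun l : Fin (j + 2) => Fin (d l)) c v l.castSucc.succ) =
        ∏ l : Fin j, choi (Φ (l.castLE hj')) (r l.castSucc, r l.succ) (c l.castSucc, c l.succ) :=
      Finset.prod_congr rfl fun l _ => by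
        rw [hcast, hcast, hsucc, hsucc]
        rfl
    rw [hprod, h0, h0, hlast, hlast, hlast', hlast', hcast, hcast]
    change _ = N u v * ρ (r 0) (c 0) * (_ * choi (Φ ⟨j, hj⟩) (r (Fin.last j), u) (c (Fin.last j), v))
    ring

theorem seqRun_trace {k : ℕ} {d : ℕ → ℕ} {Λ : ∀ i : Fin k, OpMap (Fin (d i)) (Fin (d (i + 1)))}
    (hΛ : ∀ i, IsChannel (Λ i)) (ρ : Matrix (Fin (d 0)) (Fin (d 0)) ℂ) (j : ℕ) (hj : j ≤ k) :
    (seqRun Λ ρ j hj).trace = ρ.trace := by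
  induction j with
  | zero => rfl
  | succ j ih => rw [seqRun, (hΛ _).2, ih]

theorem hasBellModel_seqCorr {k : ℕ} {X : Fin k → Type*} {A : Fin k → Type*}
    [∀ i, Fintype (A i)] {d : ℕ → ℕ} {ρ : Matrix (Fin (d 0)) (Fin (d 0)) ℂ}
    {Φ : ∀ i : Fin k, X i → A i → OpMap (Fin (d i)) (Fin (d (i + 1)))}
    (hρ : IsState ρ) (hΦ : ∀ i, IsNSInstrument (Φ i)) : HasBellModel (seqCorr Φ ρ) := by
  choose hpos Ω hΩ hsum using fun i => (hΦ i).choi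
  choose Λ hΛ hΩΛ using hΩ
  -- The initial state acts on the first label, the final trace identifies the last labels.
  let G : Matrix (∀ l : Fin (k + 1), Fin (d l)) (∀ l : Fin (k + 1), Fin (d l)) ℂ :=
    ((1 : Matrix (Fin (d k)) (Fin (d k)) ℂ).submatrix (fun r => r (Fin.last k))
      (fun r => r (Fin.last k))) ⊙ (ρᵀ.submatrix (fun r => r 0) (fun r => r 0))
  have hG : G.PosSemidef :=
    (PosSemidef.one.submatrix _).hadamard (hρ.1.transpose.submatrix _)
  have tr : ∀ Ψ : ∀ i : Fin k, OpMap (Fin (d i)) (Fin (d (i + 1))),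
      ∑ r, ∑ c, G c r * ∏ i, choi (Ψ i) (r i.castSucc, r i.succ) (c i.castSucc, c i.succ) =
        (seqRun Ψ ρ k le_rfl).trace := by
    intro Ψ
    have h : (seqRun Ψ ρ k le_rfl).trace =
        ∑ u, ∑ v, (1 : Matrix (Fin (d k)) (Fin (d k)) ℂ) u v * seqRun Ψ ρ k le_rfl u v := by
      simp [trace, one_apply]
    rw [h, sum_mul_seqRun]
    refine Finset.sum_congr rfl fun r _ => Finset.sum_congr rfl fun c _ => ?_
    simp only [G, hadamard_apply, submatrix_apply, one_apply, eq_comm]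
    rfl
  have := hasBellModel_of_sum hpos (fun i => posSemidef_of_mem_channelChoi ⟨Λ i, hΛ i, hΩΛ i⟩) hsum
    (fun (r : ∀ l : Fin (k + 1), Fin (d l)) i => (r i.castSucc, r i.succ)) hG
    (by simp only [hΩΛ]; rw [tr, seqRun_trace hΛ, hρ.2])
  simp only [tr] at this
  exact this

/-! ### Networks of combs -/

/-- The reduced combs of a comb `C`, all of them regarded as functions of the labels of all rounds:
`g m` depends only on the first `m` rounds, and tracing out the output of round `m` turns
`g (m + 1)` into `g m` times the identity on the input of that round. -/
theorem CombNormalized.exists_chain {n : ℕ} {I O : Fin n → Type} [∀ j, DecidableEq (I j)]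
    [∀ j, Fintype (O j)] {C : Matrix (∀ j, I j × O j) (∀ j, I j × O j) ℂ}
    (hC : CombNormalized n I O C) :
    ∃ g : ℕ → (∀ j, I j × O j) → (∀ j, I j × O j) → ℂ,
      (∀ r c, g 0 r c = 1) ∧ (∀ r c, g n r c = C r c) ∧
      (∀ m r r' c c', (∀ j : Fin n, j.val < m → r j = r' j) →
        (∀ j : Fin n, j.val < m → c j = c' j) → g m r c = g m r' c') ∧
      ∀ (m : Fin n) r c, ∑ o, g (m + 1) (Function.update r m ((r m).1, o))
        (Function.update c m ((c m).1, o)) = if (r m).1 = (c m).1 then g m r c else 0 := by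
  induction n with
  | zero =>
    exact ⟨fun _ _ _ => 1, fun _ _ => rfl, fun r c => (hC r c).symm, fun _ _ _ _ _ _ _ => rfl,
      fun m => m.elim0⟩
  | succ n ih =>
    obtain ⟨C', hC', htr⟩ := hC
    obtain ⟨g, h0, hn, hloc, hstep⟩ := ih hC'
    refine ⟨fun m r c => if m = n + 1 then C r c else g m (Fin.init r) (Fin.init c),
      fun r c => by simp [h0], fun r c => by simp, fun m r r' c c' hr hc => ?_, fun m r c => ?_⟩
    · by_cases hm : m = n + 1
      · subst hm
        rw [funext fun j => hr j j.2, funext fun j => hc j j.2]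
      · simp only [hm, if_false]
        exact hloc m _ _ _ _ (fun j hj => hr j.castSucc hj) fun j hj => hc j.castSucc hj
    · induction m using Fin.lastCases with
      | last =>
        have hs : ∀ (q : ∀ j, I j × O j) p, Function.update q (Fin.last n) p =
            Fin.snoc (α := fun j => I j × O j) (Fin.init q) p := fun q p => by
          conv_lhs => rw [← Fin.snoc_init_self q, Fin.update_snoc_last]
        simp only [Fin.val_last, if_true, hs, htr, hn]
        simp
      | cast m =>
        have hm : m.val ≠ n := m.2.ne
        have hm' : m.val ≠ n + 1 := by omega
        simp only [Fin.val_castSucc, Nat.add_right_cancel_iff, hm, hm', if_false,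
          Fin.init_update_castSucc]
        exact hstep m (Fin.init r) (Fin.init c)

/-- A lower set in `Fin n` consists of its first `T.card` elements. -/
theorem mem_iff_lt_card {n : ℕ} {T : Finset (Fin n)} (hT : ∀ i j, i < j → j ∈ T → i ∈ T)
    (j : Fin n) : j ∈ T ↔ j.val < T.card := by
  constructor
  · intro hj
    have h : Finset.Iic j ⊆ T := fun i hi => by
      rcases (Finset.mem_Iic.1 hi).lt_or_eq with h | rfl
      · exact hT i j h hj
      · exact hj
    have := Finset.card_le_card h
    rw [Fin.card_Iic] at this
    omega
  · intro hj
    by_contra hj'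
    have h : T ⊆ Finset.Iio j := fun i hi => Finset.mem_Iio.2 <| by
      by_contra h
      rcases (not_lt.1 h).lt_or_eq with h | rfl
      · exact hj' (hT j i h hi)
      · exact hj' hi
    have := Finset.card_le_card h
    rw [Fin.card_Iio] at this
    omega

section Rounds

variable {k : ℕ} {n : Fin k → ℕ} {E : Type} {d : E → ℕ} {src tgt : E → (i : Fin k) × Fin (n i)}

/-- The rounds of player `i` that belong to `S`. -/
def roundsIn (S : Finset ((i : Fin k) × Fin (n i))) (i : Fin k) : Finset (Fin (n i)) :=
  Finset.univ.filter fun j => ⟨i, j⟩ ∈ S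

theorem DownClosed.mem_iff_lt_card {S : Finset ((i : Fin k) × Fin (n i))}
    (hS : DownClosed (RoundBefore src tgt) S) (i : Fin k) (j : Fin (n i)) :
    ⟨i, j⟩ ∈ S ↔ j.val < (roundsIn S i).card := by
  rw [← QNet.mem_iff_lt_card (T := roundsIn S i)]
  · simp [roundsIn]
  · intro j j' hjj hj'
    simp only [roundsIn, Finset.mem_filter, Finset.mem_univ, true_and] at hj' ⊢
    exact hS _ _ (.inr ⟨i, j, j', hjj, rfl, rfl⟩) hj'

/-- The labels that player `i` sees on the legs of all his rounds. -/
def playerLabels (src tgt : E → (i : Fin k) × Fin (n i)) (i : Fin k) (r : ∀ e, Fin (d e)) :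
    ∀ j, RoundLegs d tgt i j × RoundLegs d src i j :=
  fun j => (onLegs tgt ⟨i, j⟩ r, onLegs src ⟨i, j⟩ r)

/-- `sum_wiring_eq_one` applied to the rounds as nodes: a down-closed set of rounds contains the first
few rounds of each player, and for these the player's reduced comb is inserted. -/
theorem sum_wired_combs_eq_one [Fintype E] [DecidableEq E] (hd : ∀ e, 0 < d e)
    (hR : Acyclic (RoundBefore src tgt))
    {C : ∀ i, Matrix (∀ j, RoundLegs d tgt i j × RoundLegs d src i j)
      (∀ j, RoundLegs d tgt i j × RoundLegs d src i j) ℂ}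
    (hC : ∀ i, CombNormalized (n i) (RoundLegs d tgt i) (RoundLegs d src i) (C i)) :
    ∑ r : ∀ e, Fin (d e), ∑ c : ∀ e, Fin (d e),
      ∏ i, C i (playerLabels src tgt i r) (playerLabels src tgt i c) = 1 := by
  choose g h0 hn hloc hstep using fun i => (hC i).exists_chain
  have := sum_wiring_eq_one hd hR (fun e => .inl ⟨e, rfl, rfl⟩) (fun S r c => ∏ i,
    g i (roundsIn S i).card (playerLabels src tgt i r) (playerLabels src tgt i c))
    (fun r c => by simp [roundsIn, h0]) ?_
  · simpa [roundsIn, hn] using this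
  rintro S ⟨i, j⟩ hS hS' hs r c
  have hsrc : ∀ v ∈ insert ⟨i, j⟩ S, ∀ e, tgt e = v → src e ≠ ⟨i, j⟩ := by
    intro v hv e he hes
    rcases Finset.mem_insert.1 hv with rfl | hv
    · exact hR _ (.single (.inl ⟨e, hes, he⟩))
    · exact hs (hS _ v (.inl ⟨e, hes, he⟩) hv)
  have hcard : ∀ i', i' ≠ i → roundsIn (insert ⟨i, j⟩ S) i' = roundsIn S i' := fun i' hi => by
    ext j'
    simp [roundsIn, hi]
  have hcard' : (roundsIn (insert ⟨i, j⟩ S) i).card = (roundsIn S i).card + 1 := by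
    have : roundsIn (insert ⟨i, j⟩ S) i = insert j (roundsIn S i) := by
      ext j'
      simp [roundsIn]
    rw [this, Finset.card_insert_of_notMem]
    simpa [roundsIn] using hs
  have hj : (roundsIn S i).card = j := by
    have h1 := hS.mem_iff_lt_card i j
    have h2 := (hS'.mem_iff_lt_card i j).1 (Finset.mem_insert_self _ _)
    simp only [hs, false_iff] at h1
    omega
  have hother : ∀ i' (j' : Fin (n i')), ⟨i', j'⟩ ∈ S → ∀ (q : ∀ e, Fin (d e)) o,
      playerLabels src tgt i' (relabel src ⟨i, j⟩ q o) j' = playerLabels src tgt i' q j' := by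
    intro i' j' hmem q o
    have h : ∀ e, src e = ⟨i', j'⟩ → src e ≠ ⟨i, j⟩ := fun e he h => hs (by rwa [← h, he])
    simp only [playerLabels]
    rw [onLegs_relabel_of_ne (hsrc _ (Finset.mem_insert_of_mem hmem)), onLegs_relabel_of_ne h]
  have hown : ∀ (q : ∀ e, Fin (d e)) o (j' : Fin (n i)), j'.val < j.val + 1 →
      playerLabels src tgt i (relabel src ⟨i, j⟩ q o) j' =
        Function.update (playerLabels src tgt i q) j ((playerLabels src tgt i q j).1, o) j' := by
    intro q o j' hj'
    by_cases hjj : j' = j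
    · subst hjj
      rw [Function.update_self]
      simp only [playerLabels]
      rw [onLegs_relabel_self, onLegs_relabel_of_ne (hsrc _ (Finset.mem_insert_self _ _))]
    · rw [Function.update_of_ne hjj]
      refine hother i j' ((hS.mem_iff_lt_card i j').2 ?_) q o
      have : j'.val ≠ j.val := fun h => hjj (Fin.ext h)
      omega
  have hfac : ∀ o, ∏ i', g i' (roundsIn (insert ⟨i, j⟩ S) i').card
        (playerLabels src tgt i' (relabel src ⟨i, j⟩ r o))
        (playerLabels src tgt i' (relabel src ⟨i, j⟩ c o)) =
      g i (j + 1)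
        (Function.update (playerLabels src tgt i r) j ((playerLabels src tgt i r j).1, o))
        (Function.update (playerLabels src tgt i c) j ((playerLabels src tgt i c j).1, o)) *
      ∏ i' ∈ Finset.univ.erase i, g i' (roundsIn S i').card (playerLabels src tgt i' r)
        (playerLabels src tgt i' c) := by
    intro o
    rw [← Finset.mul_prod_erase _ _ (Finset.mem_univ i), hcard', hj]
    congr 1
    · exact hloc i _ _ _ _ _ (hown r o) (hown c o)
    · refine Finset.prod_congr rfl fun i' hi' => ?_
      rw [hcard i' (Finset.ne_of_mem_erase hi')]
      exact hloc i' _ _ _ _ _ (fun j' hj' => hother i' j' ((hS.mem_iff_lt_card i' j').2 hj') r o)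
        fun j' hj' => hother i' j' ((hS.mem_iff_lt_card i' j').2 hj') c o
  simp only [hfac]
  rw [← Finset.sum_mul, hstep, ← Finset.mul_prod_erase Finset.univ (fun i' =>
    g i' (roundsIn S i').card (playerLabels src tgt i' r) (playerLabels src tgt i' c))
    (Finset.mem_univ i), hj, ite_mul, zero_mul]
  rfl

theorem hasBellModel_combCorr [Fintype E] [DecidableEq E] {X : Fin k → Type*} {A : Fin k → Type*}
    [∀ i, Fintype (A i)] {C : ∀ i, X i → A i → Matrix (∀ j, RoundLegs d tgt i j × RoundLegs d src i j)
      (∀ j, RoundLegs d tgt i j × RoundLegs d src i j) ℂ}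
    (hd : ∀ e, 0 < d e) (hR : Acyclic (RoundBefore src tgt))
    (hC : ∀ i, IsNSAssemblage (combs (RoundLegs d tgt i) (RoundLegs d src i)) (C i)) :
    HasBellModel (combCorr C) := by
  choose hpos Ω hΩ hsum using hC
  have := hasBellModel_of_sum hpos (fun i => (hΩ i).1) hsum
    (fun (r : ∀ e, Fin (d e)) i => playerLabels src tgt i r) posSemidef_ones
    (by simpa only [of_apply, one_mul] using sum_wired_combs_eq_one hd hR fun i => (hΩ i).2)
  simp only [of_apply, one_mul] at this
  exact this

end Rounds

end QNet

/-- Arbitrary compositions of `k` non-signalling quantum assemblages yield correlations with a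
`k`-partite Bell quantum model. -/
theorem theorem1 (k : ℕ) (X : Fin k → Type*) (A : Fin k → Type*) [∀ i, Fintype (A i)] :
    -- arbitrary quantum objects in an arbitrary network
    (∀ (ι : Fin k → Type) [∀ i, Fintype (ι i)] (τ : ∀ i, ObjectType (ι i))
        (W : Matrix (∀ i, ι i) (∀ i, ι i) ℂ) (O : ∀ i, X i → A i → Matrix (ι i) (ι i) ℂ),
        IsNetwork (fun i => (τ i).deterministic) W →
        (∀ i, IsNSAssemblage (τ i).deterministic (O i)) →
        HasBellModel (networkCorr W O)) ∧
    -- sequential composition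
    (∀ (d : ℕ → ℕ) (ρ : Matrix (Fin (d 0)) (Fin (d 0)) ℂ)
        (Φ : ∀ i : Fin k, X i → A i → OpMap (Fin (d i)) (Fin (d (i + 1)))),
        IsState ρ → (∀ i, IsNSInstrument (Φ i)) → HasBellModel (seqCorr Φ ρ)) ∧
    -- directed acyclic graphs
    (∀ (E : Type) [Fintype E] [DecidableEq E] (d : E → ℕ) (src tgt : E → Fin k)
        (Φ : ∀ i, X i → A i → OpMap (Legs d tgt i) (Legs d src i)),
        (∀ e, 0 < d e) → Acyclic (fun u v => ∃ e, src e = u ∧ tgt e = v) →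
        (∀ i, IsNSInstrument (Φ i)) → HasBellModel (dagCorr Φ)) ∧
    -- process matrices
    (∀ (I O : Fin k → ℕ)
        (W : Matrix (∀ i, Fin (I i) × Fin (O i)) (∀ i, Fin (I i) × Fin (O i)) ℂ)
        (Φ : ∀ i, X i → A i → OpMap (Fin (I i)) (Fin (O i))),
        IsNetwork (fun i => channelChoi (Fin (I i)) (Fin (O i))) W →
        (∀ i, IsNSInstrument (Φ i)) →
        HasBellModel (networkCorr W fun i x a => choi (Φ i x a))) ∧
    -- players with memory and several rounds (loops), exchanging messages along wires
    (∀ (n : Fin k → ℕ) (E : Type) [Fintype E] [DecidableEq E] (d : E → ℕ)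
        (src tgt : E → (i : Fin k) × Fin (n i))
        (C : ∀ i, X i → A i → Matrix (∀ j, RoundLegs d tgt i j × RoundLegs d src i j)
          (∀ j, RoundLegs d tgt i j × RoundLegs d src i j) ℂ),
        (∀ e, 0 < d e) → Acyclic (RoundBefore src tgt) →
        (∀ i, IsNSAssemblage (combs (RoundLegs d tgt i) (RoundLegs d src i)) (C i)) →
        HasBellModel (combCorr C)) ∧
    -- players with memory and several rounds in a multi-round process matrix
    (∀ (n : Fin k → ℕ) (I O : ∀ i, Fin (n i) → ℕ)
        (W : Matrix (∀ i, ∀ j, Fin (I i j) × Fin (O i j)) (∀ i, ∀ j, Fin (I i j) × Fin (O i j)) ℂ)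
        (C : ∀ i, X i → A i → Matrix (∀ j, Fin (I i j) × Fin (O i j))
          (∀ j, Fin (I i j) × Fin (O i j)) ℂ),
        IsNetwork (fun i => combs (fun j => Fin (I i j)) (fun j => Fin (O i j))) W →
        (∀ i, IsNSAssemblage (combs (fun j => Fin (I i j)) (fun j => Fin (O i j))) (C i)) →
        HasBellModel (networkCorr W C)) := by
  refine ⟨fun ι _ τ W O hW hO => hasBellModel_networkCorr (fun i Ω hΩ => hΩ.1) hW hO,
    fun d ρ Φ hρ hΦ => hasBellModel_seqCorr hρ hΦ,
    fun E _ _ d src tgt Φ hd hR hΦ => hasBellModel_dagCorr hd hR hΦ,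
    fun I O W Φ hW hΦ => hasBellModel_networkCorr
      (fun i Ω hΩ => posSemidef_of_mem_channelChoi hΩ) hW fun i => (hΦ i).choi,
    fun n E _ _ d src tgt C hd hR hC => hasBellModel_combCorr hd hR hC,
    fun n I O W C hW hC => hasBellModel_networkCorr (fun i Ω hΩ => hΩ.1) hW hC⟩
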